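/- Let $\omega=\tfrac{1+i\sqrt3}{2}$ and $\mathbb Z[\omega]=\{a+b\omega : a,b\in\mathbb Z\}\subset\mathbb C$. For $\alpha=a+b\omega\in\mathbb Z[\omega]$ let $\overline\alpha=a+b\overline\omega$ be its conjugate, $\operatorname{Im}\alpha:=b$ (the coordinate of $\alpha$ in the basis $(1,\omega)$, not the usual imaginary part) and $N(\alpha)=\alpha\overline\alpha$. Let $\tau$ be the Archimedean tessellation of type $(3^4.6)$ of the Euclidean plane $\mathbb C$ (in either of its two mirror-image forms), scaled and rotated so that $1$ and $\omega$ are its shortest translational symmetries; thus its group $T_\tau$ of translational symmetries is identified with $\mathbb Z[\omega]$. For non-collinear $\alpha,\beta\in\mathbb Z[\omega]$ let $\tau_{\alpha,\beta}=\tau/\langle\alpha,\beta\rangle$ be the quotient map on the torus, and for $\eta\in\mathbb Z[\omega]\setminus\{0\}$ put $\tau_\eta:=\tau_{\eta,\omega\eta}$. A toroidal map $\tau/G$ has this form with $G\le T_\tau$ generated by two linearly independent translations. Its flags are the $G$-orbits of flags (incident vertex–edge–face triples) of $\tau$, and its automorphism group is the group induced on it by the normalizer of $G$ in the symmetry group of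 $\tau$. The map $\tau/G$ is called almost regular if it has the same number of flag orbits under its automorphism group as $\tau$ has under the symmetry group of $\tau$. The map $\tau/H$ covers $\tau/G$ if $H\le G$; the covering sends each $H$-orbit to the $G$-orbit containing it. A minimal almost regular cover of $\tau/G$ is a minimal element, with respect to the covering order (in which $\mathcal M\le\mathcal N$ if $\mathcal N$ covers $\mathcal M$), among the almost regular maps that cover $\tau/G$. **Theorem.** Let $\alpha,\beta\in\mathbb Z[\omega]$ be non-collinear (linearly independent over $\mathbb R$), and let $\gamma$ be a greatest common divisor of $\alpha$ and $\beta$ in $\mathbb Z[\omega]$. Then $N(\gamma)\neq0$ divides $\operatorname{Im}(\overline\alpha\beta)$, and with $$\eta=\frac{\operatorname{Im}(\overline\alpha\beta)}{N(\gamma)}\,\gamma$$ we have $\eta\ne0$ and $\tau_\eta$ is the unique minimal almost regular cover of $\tau_{\alpha,\beta}$. Moreover, the number of sheets of the covering $\tau_\eta\to\tau_{\alpha,\beta}$, that is, the index $[\langle\alpha,\beta\rangle:\langle\eta,\omega\eta\rangle]$ (the number of fundamental regions of $\tau_{\alpha,\beta}$ glued together to obtain a fundamental region of $\tau_\eta$),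 which is also the number of flags of $\tau_\eta$ over each flag of $\tau_{\alpha,\beta}$, equals $$K_{\min}=\frac{|\operatorname{Im}(\overline\alpha\beta)|}{N(\gamma)}.$$ -/

import Mathlib

open scoped QuadraticAlgebra

noncomputable section

/-! ### Tessellations of the Euclidean plane `ℂ`, their symmetries and flags -/

/-- A tessellation of the plane, recorded by its vertices, its edges (closed segments) and its
faces (closed polygons). -/
structure PlaneTessellation where
  vertices : Set ℂ
  edges : Set (Set ℂ)
  faces : Set (Set ℂ)

namespace PlaneTessellation

variable (τ : PlaneTessellation)

/-- The symmetry group: all isometries of the plane that preserve the tessellation. -/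
def symmetryGroup : Subgroup (ℂ ≃ᵢ ℂ) where
  carrier := {g | (∀ z, g z ∈ τ.vertices ↔ z ∈ τ.vertices) ∧
    (∀ s : Set ℂ, g '' s ∈ τ.edges ↔ s ∈ τ.edges) ∧
    (∀ s : Set ℂ, g '' s ∈ τ.faces ↔ s ∈ τ.faces)}
  one_mem' := by simp
  mul_mem' := by
    rintro g h ⟨g1, g2, g3⟩ ⟨h1, h2, h3⟩
    refine ⟨fun z => ?_, fun s => ?_, fun s => ?_⟩
    · rw [IsometryEquiv.mul_apply, g1, h1]
    · rw [IsometryEquiv.coe_mul, Set.image_comp, g2, h2]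
    · rw [IsometryEquiv.coe_mul, Set.image_comp, g3, h3]
  inv_mem' := by
    rintro g ⟨g1, g2, g3⟩
    have key : ∀ s : Set ℂ, g '' ((g⁻¹ : ℂ ≃ᵢ ℂ) '' s) = s := fun s => by
      rw [← Set.image_comp, ← IsometryEquiv.coe_mul, mul_inv_cancel, IsometryEquiv.coe_one,
        Set.image_id]
    refine ⟨fun z => ?_, fun s => ?_, fun s => ?_⟩
    · rw [← g1, IsometryEquiv.apply_inv_self]
    · rw [← g2, key]
    · rw [← g3, key]

/-- The translation group `T_τ`: all translations among the symmetries. -/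
def translationGroup : Subgroup τ.symmetryGroup where
  carrier := {g | ∃ t : ℂ, ∀ z, g.1 z = z + t}
  one_mem' := ⟨0, fun z => by simp⟩
  mul_mem' := by
    rintro g h ⟨s, hs⟩ ⟨t, ht⟩
    refine ⟨t + s, fun z => ?_⟩
    rw [Subgroup.coe_mul, IsometryEquiv.mul_apply, ht, hs, add_assoc]
  inv_mem' := by
    rintro g ⟨t, ht⟩
    refine ⟨-t, fun z => ?_⟩
    apply g.1.injective
    rw [Subgroup.coe_inv, IsometryEquiv.apply_inv_self, ht]
    ring

/-- A flag: an incident triple of a vertex, an edge and a face. -/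
@[ext] structure Flag where
  vertex : ℂ
  edge : Set ℂ
  face : Set ℂ
  vertex_mem : vertex ∈ τ.vertices
  edge_mem : edge ∈ τ.edges
  face_mem : face ∈ τ.faces
  vertex_mem_edge : vertex ∈ edge
  edge_subset_face : edge ⊆ face

variable {τ}

/-- The symmetry group acts on the flags. -/
instance : MulAction τ.symmetryGroup τ.Flag where
  smul g Φ :=
    { vertex := g.1 Φ.vertex
      edge := g.1 '' Φ.edge
      face := g.1 '' Φ.face
      vertex_mem := (g.2.1 _).2 Φ.vertex_mem
      edge_mem := (g.2.2.1 _).2 Φ.edge_mem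
      face_mem := (g.2.2.2 _).2 Φ.face_mem
      vertex_mem_edge := Set.mem_image_of_mem _ Φ.vertex_mem_edge
      edge_subset_face := Set.image_mono Φ.edge_subset_face }
  one_smul _ := Flag.ext rfl (Set.image_id _) (Set.image_id _)
  mul_smul g h _ := Flag.ext rfl (Set.image_comp g.1 h.1 _) (Set.image_comp g.1 h.1 _)

/-- Two flags of the plane are adjacent if they differ in exactly one element. -/
def Flag.Adjacent (Φ Ψ : τ.Flag) : Prop :=
  (Φ.vertex ≠ Ψ.vertex ∧ Φ.edge = Ψ.edge ∧ Φ.face = Ψ.face) ∨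
  (Φ.vertex = Ψ.vertex ∧ Φ.edge ≠ Ψ.edge ∧ Φ.face = Ψ.face) ∨
  (Φ.vertex = Ψ.vertex ∧ Φ.edge = Ψ.edge ∧ Φ.face ≠ Ψ.face)

variable (τ)

/-- The number of flag orbits of the tessellation under its symmetry group. -/
def numFlagOrbits : ℕ∞ := ENat.card (MulAction.orbitRel.Quotient τ.symmetryGroup τ.Flag)

/-! ### Toroidal maps `τ / G` -/

/-- A toroidal map `τ / G`: `G ≤ T_τ` is generated by two translations with linearly independent
translation vectors (the vector of a translation `g` being `g 0`). -/
@[ext] structure ToroidalMap where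
  group : Subgroup τ.symmetryGroup
  exists_generators : ∃ g ∈ τ.translationGroup, ∃ h ∈ τ.translationGroup,
    LinearIndependent ℝ ![g.1 0, h.1 0] ∧ group = Subgroup.closure {g, h}

namespace ToroidalMap

variable {τ} (N M : τ.ToroidalMap)

/-- The flags of `τ / G` are the `G`-orbits of flags of `τ`. -/
abbrev Flag : Type := MulAction.orbitRel.Quotient M.group τ.Flag

/-- The orbit of a flag of `τ`, as a flag of `τ / G`. -/
def proj (Φ : τ.Flag) : M.Flag := Quotient.mk'' Φ

/-- Flags of `τ / G` are adjacent if they lift to adjacent flags of the plane. -/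
def Adjacent (x y : M.Flag) : Prop :=
  ∃ Φ Ψ : τ.Flag, M.proj Φ = x ∧ M.proj Ψ = y ∧ Φ.Adjacent Ψ

/-- `Sym(τ / G)`: the normalizer of `G` in the symmetry group of `τ`. -/
abbrev sym : Subgroup τ.symmetryGroup := Subgroup.normalizer (M.group : Set τ.symmetryGroup)

/-- A symmetry of `τ` normalizing `G` acts on the flags of `τ / G`. -/
instance : MulAction M.sym M.Flag where
  smul n := Quotient.map' (fun Φ : τ.Flag => (n : τ.symmetryGroup) • Φ) (by
    rintro Φ Ψ ⟨g, rfl⟩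
    refine ⟨⟨n * g * (n : τ.symmetryGroup)⁻¹, (n.2 g.1).1 g.2⟩, ?_⟩
    change ((n : τ.symmetryGroup) * g * (n : τ.symmetryGroup)⁻¹) • (n : τ.symmetryGroup) • Ψ =
      (n : τ.symmetryGroup) • (g : τ.symmetryGroup) • Ψ
    rw [smul_smul, smul_smul, inv_mul_cancel_right])
  one_smul x := by
    induction x using Quotient.inductionOn' with
    | h Φ => exact congrArg Quotient.mk'' (one_smul τ.symmetryGroup Φ)
  mul_smul m n x := by
    induction x using Quotient.inductionOn' with
    | h Φ => exact congrArg Quotient.mk'' (mul_smul (m : τ.symmetryGroup) (n : τ.symmetryGroup) Φ)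

/-- `Aut(τ / G)`: the group induced on the map by the normalizer of `G`. -/
def autGroup : Subgroup (Equiv.Perm M.Flag) := (MulAction.toPermHom M.sym M.Flag).range

/-- The number of flag orbits of a toroidal map under its automorphism group. -/
def numFlagOrbits : ℕ∞ := ENat.card (MulAction.orbitRel.Quotient M.autGroup M.Flag)

/-- A toroidal map `τ / G` is almost regular if it has as many flag orbits under its automorphism
group as `τ` has under its symmetry group. -/
def IsAlmostRegular : Prop := M.numFlagOrbits = τ.numFlagOrbits

/-- `N = τ / H` is a cover of `M = τ / G` if `H ≤ G`; the covering itself is `coveringMap`. -/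
def Covers : Prop := N.group ≤ M.group

variable {N M}

/-- The covering `τ / H → τ / G`, for `H ≤ G`, on flags: `H`-orbits are sent to the `G`-orbits
containing them. -/
def coveringMap (h : N.Covers M) : N.Flag → M.Flag :=
  Quotient.map' id (by
    rintro Φ Ψ ⟨g, hg⟩
    exact ⟨⟨g.1, h g.2⟩, hg⟩)

theorem coveringMap_surjective (h : N.Covers M) : Function.Surjective (coveringMap h) := by
  intro x
  induction x using Quotient.inductionOn' with
  | h Φ => exact ⟨N.proj Φ, rfl⟩

theorem coveringMap_adjacent (h : N.Covers M) {x y : N.Flag} (hxy : N.Adjacent x y) :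
    M.Adjacent (coveringMap h x) (coveringMap h y) := by
  obtain ⟨Φ, Ψ, rfl, rfl, hA⟩ := hxy
  exact ⟨Φ, Ψ, rfl, rfl, hA⟩

variable (N M)

/-- `N` is a minimal almost regular cover of `M`: it is a minimal element, in the order in which
`M ≤ N` means that `N` covers `M`, of the set of all almost regular covers of `M`. -/
def IsMinimalAlmostRegularCoverOf : Prop :=
  N.IsAlmostRegular ∧ N.Covers M ∧
    ∀ N' : τ.ToroidalMap, N'.IsAlmostRegular → N'.Covers M → N.Covers N' → N' = N

end ToroidalMap

end PlaneTessellation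

/-! ### The Eisenstein integers -/

/-- The Eisenstein integers `ℤ[ω]`, with `ω ^ 2 = -1 + ω`. For `α = a + b * ω`, `α.re = a` and
`α.im = b` are the coordinates of `α` in the basis `(1, ω)`, `star α` is the conjugate and
`α.norm = α * star α`. -/
abbrev Eisenstein : Type := QuadraticAlgebra ℤ (-1) 1

namespace Eisenstein

/-- The complex number `ω = (1 + i√3) / 2`. -/
def omegaC : ℂ := (1 + Complex.I * (Real.sqrt 3 : ℝ)) / 2

theorem omegaC_mul_self : omegaC * omegaC = omegaC - 1 := by
  have h : ((Real.sqrt 3 : ℝ) : ℂ) * ((Real.sqrt 3 : ℝ) : ℂ) = 3 := by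
    rw [← Complex.ofReal_mul, Real.mul_self_sqrt (by norm_num)]
    norm_num
  unfold omegaC
  linear_combination (Complex.I * Complex.I / 4) * h + (3 / 4 : ℂ) * Complex.I_mul_I

/-- The inclusion `ℤ[ω] → ℂ`, `a + b * ω ↦ a + b * (1 + i√3) / 2`. -/
def toComplex : Eisenstein →+* ℂ where
  toFun x := x.re + x.im * omegaC
  map_zero' := by simp
  map_one' := by simp
  map_add' x y := by simp; ring
  map_mul' x y := by
    simp only [QuadraticAlgebra.re_mul, QuadraticAlgebra.im_mul]
    push_cast
    linear_combination (-(x.im : ℂ) * y.im) * omegaC_mul_self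

/-- `γ` is a greatest common divisor of `α` and `β` (determined up to associates). -/
def IsGCD (γ α β : Eisenstein) : Prop :=
  γ ∣ α ∧ γ ∣ β ∧ ∀ δ : Eisenstein, δ ∣ α → δ ∣ β → δ ∣ γ

end Eisenstein

/-! ### The tessellation `(3⁴.6)` -/

namespace SnubHexagonal

open Eisenstein

/-- The points of the triangular lattice `μ⁻¹ ℤ[ω]` that do not lie in `ℤ[ω]`. -/
def vertexSet (μ : Eisenstein) : Set ℂ :=
  {z | (∃ x : Eisenstein, toComplex μ * z = toComplex x) ∧ ¬ ∃ c : Eisenstein, z = toComplex c}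

/-- The common side length of all polygons, `1 / √7`. -/
def side : ℝ := 1 / Real.sqrt 7

/-- For `N(μ) = 7` this is the Archimedean tessellation `(3⁴.6)`, placed so that its shortest
translations are `1` and `ω` and that the centres of its hexagons are the points of `ℤ[ω]`:
the triangular tessellation with vertex set `μ⁻¹ ℤ[ω]` and side `1 / √7`, in which the six triangles
around every point of `ℤ[ω]` are merged into a regular hexagon. (Up to associates there are two `μ`
of norm `7`, namely `2 + ω` and `3 - ω`; they give the two mirror images of the tessellation.) -/
def tessellation (μ : Eisenstein) : PlaneTessellation where
  vertices := vertexSet μ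
  edges := {e | ∃ v ∈ vertexSet μ, ∃ w ∈ vertexSet μ, dist v w = side ∧ e = segment ℝ v w}
  faces := {f |
    (∃ u ∈ vertexSet μ, ∃ v ∈ vertexSet μ, ∃ w ∈ vertexSet μ,
      dist u v = side ∧ dist v w = side ∧ dist u w = side ∧ f = convexHull ℝ {u, v, w}) ∨
    (∃ c : Eisenstein, f = convexHull ℝ {v | v ∈ vertexSet μ ∧ dist v (toComplex c) = side})}

variable (μ : Eisenstein)

theorem add_mem_vertexSet (t : Eisenstein) {z : ℂ} (hz : z ∈ vertexSet μ) :
    z + toComplex t ∈ vertexSet μ := by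
  obtain ⟨⟨x, hx⟩, hn⟩ := hz
  refine ⟨⟨x + μ * t, ?_⟩, ?_⟩
  · rw [mul_add, hx, map_add, map_mul]
  · rintro ⟨c, hc⟩
    exact hn ⟨c - t, by rw [map_sub, ← hc]; ring⟩

theorem image_segment (t v w : ℂ) :
    (fun z => z + t) '' segment ℝ v w = segment ℝ (v + t) (w + t) := by
  simpa [add_comm] using segment_translate_image ℝ t v w

theorem image_convexHull (t : ℂ) (s : Set ℂ) :
    (fun z => z + t) '' convexHull ℝ s = convexHull ℝ ((fun z => z + t) '' s) := by
  have h := (AffineEquiv.constVAdd ℝ ℂ t).toAffineMap.image_convexHull s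
  simpa [add_comm] using h

theorem image_edge (t : Eisenstein) {s : Set ℂ} (hs : s ∈ (tessellation μ).edges) :
    (fun z => z + toComplex t) '' s ∈ (tessellation μ).edges := by
  obtain ⟨v, hv, w, hw, hd, rfl⟩ := hs
  exact ⟨_, add_mem_vertexSet μ t hv, _, add_mem_vertexSet μ t hw, by rwa [dist_add_right],
    image_segment _ _ _⟩

theorem image_face (t : Eisenstein) {s : Set ℂ} (hs : s ∈ (tessellation μ).faces) :
    (fun z => z + toComplex t) '' s ∈ (tessellation μ).faces := by
  rcases hs with ⟨u, hu, v, hv, w, hw, h1, h2, h3, rfl⟩ | ⟨c, rfl⟩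
  · refine Or.inl ⟨_, add_mem_vertexSet μ t hu, _, add_mem_vertexSet μ t hv, _,
      add_mem_vertexSet μ t hw, by rwa [dist_add_right], by rwa [dist_add_right],
      by rwa [dist_add_right], ?_⟩
    rw [image_convexHull, Set.image_insert_eq, Set.image_insert_eq, Set.image_singleton]
  · refine Or.inr ⟨c + t, ?_⟩
    rw [image_convexHull]
    congr 1
    ext z
    constructor
    · rintro ⟨v, ⟨hv, hd⟩, rfl⟩
      exact ⟨add_mem_vertexSet μ t hv, by rwa [map_add, dist_add_right]⟩
    · rintro ⟨hv, hd⟩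
      refine ⟨z - toComplex t, ⟨?_, ?_⟩, by simp⟩
      · simpa [sub_eq_add_neg] using add_mem_vertexSet μ (-t) hv
      · rw [← dist_add_right _ _ (toComplex t), ← map_add]
        simpa using hd

/-- The translation `z ↦ z + t` by `t ∈ ℤ[ω]`, as a symmetry of the tessellation. -/
def translation (t : Eisenstein) : (tessellation μ).symmetryGroup :=
  ⟨IsometryEquiv.addRight (toComplex t), by
    have key : ∀ s : Set ℂ, (fun z => z + toComplex (-t)) '' ((fun z => z + toComplex t) '' s) = s :=
      fun s => by
        rw [← Set.image_comp]
        simp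
    refine ⟨fun z => ⟨fun h => ?_, fun h => add_mem_vertexSet μ t h⟩,
      fun s => ⟨fun h => ?_, fun h => image_edge μ t h⟩,
      fun s => ⟨fun h => ?_, fun h => image_face μ t h⟩⟩
    · have h' : z + toComplex t + toComplex (-t) ∈ vertexSet μ := add_mem_vertexSet μ (-t) h
      rwa [map_neg, add_neg_cancel_right] at h'
    · rw [← key s]
      exact image_edge μ (-t) h
    · rw [← key s]
      exact image_face μ (-t) h⟩

theorem translation_mem (t : Eisenstein) :
    translation μ t ∈ (tessellation μ).translationGroup :=
  ⟨toComplex t, fun _ => rfl⟩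

/-- The toroidal map `τ_{α,β} = τ / ⟨α, β⟩` for non-collinear `α, β ∈ ℤ[ω]`. -/
def torus (α β : Eisenstein) (h : LinearIndependent ℝ ![toComplex α, toComplex β]) :
    (tessellation μ).ToroidalMap where
  group := Subgroup.closure {translation μ α, translation μ β}
  exists_generators := by
    refine ⟨_, translation_mem μ α, _, translation_mem μ β, ?_, rfl⟩
    simpa [translation] using h

end SnubHexagonal

end

/-! The tessellation is chiral, so each of its symmetries has the form z ↦ uz + b with u a unit of
ℤ[ω] and b ∈ ℤ[ω] (`exists_symmetry_eq`). Translations are therefore exactly ℤ[ω], and conjugating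
the translation by t with such a symmetry gives the translation by ut. Since some flag has trivial
stabilizer and there are finitely many flag orbits, τ/G is almost regular iff G is normal in the
whole symmetry group (`isAlmostRegular_iff_normal`), that is, iff the lattice of G is an ideal of
ℤ[ω] (`isAlmostRegular_iff`).

Almost regular covers of τ_{α,β} thus correspond to nonzero ideals inside Λ = ⟨α, β⟩, and a largest
such ideal gives a least cover, hence the unique minimal one. The largest ideal consists of the x
with x, ωx ∈ Λ. Put D = Im(ᾱβ). By Cramer's rule x ∈ Λ iff D divides Im(ᾱx) and Im(β̄x); imposing
this on ωx as well means that D divides ᾱx and β̄x in ℤ[ω], equivalently D ∣ γ̄x. As D = kγγ̄ with k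
∈ ℤ, this says kγ ∣ x, so the ideal is generated by η = kγ (`IsGCD.dvd_iff_mem_lattice`).

The indices of Λ and (η) in ℤ[ω] are |D| = |k|N(γ) and N(η) = k²N(γ), with quotient |k|.
Translations act freely on flags, so fibres have this size too (`card_fibre`). -/

namespace Eisenstein

/-! ### Arithmetic of ℤ[ω] and its sublattices -/

theorem norm_eq (x : Eisenstein) : x.norm = x.re ^ 2 + x.re * x.im + x.im ^ 2 := by
  rw [QuadraticAlgebra.norm_def]
  ring

theorem norm_nonneg (x : Eisenstein) : 0 ≤ x.norm := by
  rw [norm_eq]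
  nlinarith [sq_nonneg (x.re + x.im), sq_nonneg x.re, sq_nonneg x.im]

theorem norm_eq_zero {x : Eisenstein} : x.norm = 0 ↔ x = 0 := by
  refine ⟨fun h => ?_, fun h => by rw [h, QuadraticAlgebra.norm_zero]⟩
  rw [norm_eq] at h
  have h1 : x.re ^ 2 = 0 := by
    nlinarith [sq_nonneg (x.re + x.im), sq_nonneg x.re, sq_nonneg x.im]
  have h2 : x.im ^ 2 = 0 := by
    nlinarith [sq_nonneg (x.re + x.im), sq_nonneg x.re, sq_nonneg x.im]
  ext
  · simpa using h1
  · simpa using h2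

theorem norm_pos {x : Eisenstein} (hx : x ≠ 0) : 0 < x.norm :=
  lt_of_le_of_ne (norm_nonneg x) fun h => hx (norm_eq_zero.1 h.symm)

theorem mul_star_self (x : Eisenstein) : x * star x = (x.norm : Eisenstein) := by
  rw [← QuadraticAlgebra.algebraMap_norm_eq_mul_star, eq_intCast]

theorem intCast_mul_cancel {n : ℤ} (hn : n ≠ 0) {x y : Eisenstein}
    (h : (n : Eisenstein) * x = n * y) : x = y := by
  have h1 := congrArg QuadraticAlgebra.re h
  have h2 := congrArg QuadraticAlgebra.im h
  simp at h1 h2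
  ext
  · exact h1.resolve_right hn
  · exact h2.resolve_right hn

theorem intCast_dvd_iff {n : ℤ} {x : Eisenstein} :
    (n : Eisenstein) ∣ x ↔ n ∣ x.re ∧ n ∣ x.im := by
  constructor
  · rintro ⟨y, rfl⟩
    simp
  · rintro ⟨⟨a, ha⟩, ⟨b, hb⟩⟩
    exact ⟨⟨a, b⟩, by ext <;> simp [ha, hb]⟩

/-- Division with remainder. -/
theorem exists_norm_sub_mul_lt (x : Eisenstein) {y : Eisenstein} (hy : y ≠ 0) :
    ∃ q : Eisenstein, (x - q * y).norm < y.norm := by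
  have hn := norm_pos hy
  set n := y.norm with hn'
  set z := x * star y with hz
  -- Since x / y = z / n, the quotient is found by rounding both coordinates of z / n to nearest
  -- integers. The errors u / n and v / n are at most 1/2, and u² + uv + v² ≤ (3/4)n² < n².
  obtain ⟨a, ha1, ha2⟩ : ∃ a : ℤ, -n ≤ 2 * (z.re - a * n) ∧ 2 * (z.re - a * n) ≤ n := by
    refine ⟨(2 * z.re + n) / (2 * n), ?_, ?_⟩
    · have := Int.ediv_mul_le (2 * z.re + n) (b := 2 * n) (by omega)
      linarith
    · have := Int.lt_ediv_add_one_mul_self (2 * z.re + n) (b := 2 * n) (by omega)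
      linarith
  obtain ⟨b, hb1, hb2⟩ : ∃ b : ℤ, -n ≤ 2 * (z.im - b * n) ∧ 2 * (z.im - b * n) ≤ n := by
    refine ⟨(2 * z.im + n) / (2 * n), ?_, ?_⟩
    · have := Int.ediv_mul_le (2 * z.im + n) (b := 2 * n) (by omega)
      linarith
    · have := Int.lt_ediv_add_one_mul_self (2 * z.im + n) (b := 2 * n) (by omega)
      linarith
  refine ⟨⟨a, b⟩, ?_⟩
  have hprod : (x - ⟨a, b⟩ * y) * star y = ⟨z.re - a * n, z.im - b * n⟩ := by
    rw [sub_mul, mul_assoc, mul_star_self, ← hz, ← hn']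
    ext <;> simp
  have h := congrArg QuadraticAlgebra.norm hprod
  rw [map_mul, QuadraticAlgebra.norm_star, ← hn', norm_eq ⟨z.re - a * n, z.im - b * n⟩] at h
  dsimp only at h
  set u := z.re - a * n
  set v := z.im - b * n
  have h1 : u ^ 2 * 4 ≤ n ^ 2 := by nlinarith
  have h2 : v ^ 2 * 4 ≤ n ^ 2 := by nlinarith
  have h3 : 2 * (u * v) ≤ u ^ 2 + v ^ 2 := by nlinarith [sq_nonneg (u - v)]
  have h4 : (x - ⟨a, b⟩ * y).norm * n < n * n := by nlinarith
  exact lt_of_mul_lt_mul_right h4 hn.le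

/-- Bézout: a nonzero element of least norm in the ideal (α, β) divides every element of it, as a
nonzero remainder would have smaller norm. -/
theorem exists_span_pair_eq (α β : Eisenstein) :
    ∃ δ : Eisenstein, δ ∣ α ∧ δ ∣ β ∧ ∃ s t, δ = s * α + t * β := by
  by_cases h0 : α = 0 ∧ β = 0
  · exact ⟨0, by simp [h0.1], by simp [h0.2], 0, 0, by simp⟩
  let P : ℕ → Prop := fun n => ∃ s t : Eisenstein, s * α + t * β ≠ 0 ∧
    (s * α + t * β).norm.toNat = n
  have hP : ∃ n, P n := by
    by_cases hα : α = 0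
    · exact ⟨_, 0, 1, by simpa using fun h => h0 ⟨hα, h⟩, rfl⟩
    · exact ⟨_, 1, 0, by simpa using hα, rfl⟩
  classical
  obtain ⟨s, t, hδ, hn⟩ := Nat.find_spec hP
  have key : ∀ a b : Eisenstein, (s * α + t * β) ∣ a * α + b * β := by
    intro a b
    obtain ⟨q, hq⟩ := exists_norm_sub_mul_lt (a * α + b * β) hδ
    by_cases hr : a * α + b * β - q * (s * α + t * β) = 0
    · exact ⟨q, by rw [sub_eq_zero.1 hr, mul_comm]⟩
    · have hr' : (a - q * s) * α + (b - q * t) * β =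
          a * α + b * β - q * (s * α + t * β) := by ring
      have hmin := Nat.find_min' hP ⟨a - q * s, b - q * t, by rwa [hr'], rfl⟩
      rw [hr', ← hn] at hmin
      have := norm_nonneg (a * α + b * β - q * (s * α + t * β))
      omega
  exact ⟨_, by simpa using key 1 0, by simpa using key 0 1, s, t, rfl⟩

/-- A Bézout combination δ has the required divisibility, and δ ∣ γ because γ is a greatest common
divisor. -/
theorem IsGCD.dvd_mul {α β γ : Eisenstein} (h : IsGCD γ α β) {d x : Eisenstein}
    (h1 : d ∣ α * x) (h2 : d ∣ β * x) : d ∣ γ * x := by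
  obtain ⟨δ, hα, hβ, s, t, hst⟩ := exists_span_pair_eq α β
  have hd : d ∣ δ * x := by
    rw [hst, add_mul, mul_assoc, mul_assoc]
    exact dvd_add (h1.mul_left s) (h2.mul_left t)
  exact hd.trans (mul_dvd_mul_right (h.2.2 δ hα hβ) x)

theorem IsGCD.norm_dvd {α β γ : Eisenstein} (h : IsGCD γ α β) :
    γ.norm ∣ (star α * β).im := by
  obtain ⟨⟨a, rfl⟩, ⟨b, rfl⟩, -⟩ := h
  have : star (γ * a) * (γ * b) = (γ.norm : Eisenstein) * (star a * b) := by
    rw [star_mul, ← mul_star_self]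
    ring
  rw [this]
  simp

/-- Cramer's rule for the alternating form Im(x̄y): D x = -Im(β̄x) α + Im(ᾱx) β with D = Im(ᾱβ). -/
theorem mem_lattice_iff {α β x : Eisenstein} (hD : (star α * β).im ≠ 0) :
    (∃ p q : ℤ, p • α + q • β = x) ↔
      (star α * β).im ∣ (star α * x).im ∧ (star α * β).im ∣ (star β * x).im := by
  constructor
  · rintro ⟨p, q, rfl⟩
    refine ⟨⟨q, ?_⟩, ⟨-p, ?_⟩⟩ <;> simp <;> ring
  · rintro ⟨⟨q, hq⟩, ⟨p, hp⟩⟩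
    refine ⟨-p, q, intCast_mul_cancel hD ?_⟩
    have : ((star α * β).im : Eisenstein) * x =
        ((-(star β * x).im : ℤ) : Eisenstein) * α + ((star α * x).im : ℤ) * β := by
      ext <;> simp <;> ring
    rw [this, hq, hp]
    simp only [zsmul_eq_mul]
    push_cast
    ring

/-- The largest ideal contained in the lattice spanned by `α` and `β` is generated by
`(Im (star α * β) / N γ) • γ`. -/
theorem IsGCD.dvd_iff_mem_lattice {α β γ x : Eisenstein} (h : IsGCD γ α β)
    (hD : (star α * β).im ≠ 0) :
    ((star α * β).im / γ.norm) • γ ∣ x ↔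
      (∃ p q : ℤ, p • α + q • β = x) ∧
        ∃ p q : ℤ, p • α + q • β = QuadraticAlgebra.omega * x := by
  rw [mem_lattice_iff hD, mem_lattice_iff hD]
  obtain ⟨k, hk⟩ := h.norm_dvd
  have hγ : γ.norm ≠ 0 := by
    rintro h0
    rw [h0, zero_mul] at hk
    exact hD hk
  rw [hk, Int.mul_ediv_cancel_left _ hγ, ← hk]
  set D := (star α * β).im with hD'
  -- Im(ωy) = re y + im y, so the two imaginary parts determine both coordinates of y modulo D.
  have aux : ∀ y : Eisenstein, D ∣ y.im ∧ D ∣ (QuadraticAlgebra.omega * y).im ↔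
      (D : Eisenstein) ∣ y := by
    intro y
    rw [intCast_dvd_iff]
    simp only [QuadraticAlgebra.im_mul, QuadraticAlgebra.omega_re, QuadraticAlgebra.omega_im,
      zero_mul, one_mul, zero_add]
    constructor
    · rintro ⟨h1, h2⟩
      exact ⟨(dvd_add_left h1).1 h2, h1⟩
    · rintro ⟨h1, h2⟩
      exact ⟨h2, dvd_add h1 h2⟩
  have aux' : (D ∣ (star α * x).im ∧ D ∣ (star β * x).im) ∧
      (D ∣ (star α * (QuadraticAlgebra.omega * x)).im ∧
        D ∣ (star β * (QuadraticAlgebra.omega * x)).im) ↔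
      (D : Eisenstein) ∣ star α * x ∧ (D : Eisenstein) ∣ star β * x := by
    rw [← aux, ← aux, mul_left_comm (star α), mul_left_comm (star β)]
    tauto
  rw [aux']
  -- D is a rational integer, hence fixed by conjugation. This moves the bar off α and β, so that
  -- the gcd property of γ applies.
  have hstar : ∀ y z : Eisenstein, (D : Eisenstein) ∣ y * star z ↔ (D : Eisenstein) ∣ star y * z := by
    have : ∀ y z : Eisenstein, (D : Eisenstein) ∣ y * star z → (D : Eisenstein) ∣ star y * z := by
      rintro y z ⟨w, hw⟩
      refine ⟨star w, ?_⟩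
      have := congrArg star hw
      rw [star_mul, star_mul, star_star, star_intCast] at this
      rw [mul_comm, this, mul_comm]
    exact fun y z => ⟨this y z, fun h => by simpa using this (star y) (star z) (by simpa using h)⟩
  have hDk : (D : Eisenstein) = γ.norm * k := by rw [hk]; push_cast; rfl
  -- Both directions pass through D ∣ γ̄x, which is equivalent to kγ ∣ x because D = kγγ̄.
  constructor
  · intro hx
    have hγx : (D : Eisenstein) ∣ star γ * x := by
      obtain ⟨y, rfl⟩ := hx
      refine ⟨y, ?_⟩
      rw [hDk, ← mul_star_self, zsmul_eq_mul]
      ring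
    rw [← hstar] at hγx
    rw [← hstar, ← hstar]
    exact ⟨hγx.trans (mul_dvd_mul_right h.1 _), hγx.trans (mul_dvd_mul_right h.2.1 _)⟩
  · rintro ⟨h1, h2⟩
    rw [← hstar] at h1 h2
    obtain ⟨y, hy⟩ := (hstar _ _).1 (h.dvd_mul h1 h2)
    refine ⟨y, intCast_mul_cancel hγ ?_⟩
    rw [← mul_star_self, mul_assoc, hy, hDk, zsmul_eq_mul, ← mul_star_self]
    ring

theorem im_star_mul_omega_mul (η : Eisenstein) :
    (star η * (QuadraticAlgebra.omega * η)).im = η.norm := by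
  simp [norm_eq]
  ring

theorem dvd_iff_exists_smul_add {η x : Eisenstein} :
    (∃ p q : ℤ, p • η + q • (QuadraticAlgebra.omega * η) = x) ↔ η ∣ x := by
  constructor
  · rintro ⟨p, q, rfl⟩
    refine ⟨(p : Eisenstein) + (q : Eisenstein) * QuadraticAlgebra.omega, ?_⟩
    simp only [zsmul_eq_mul]
    ring
  · rintro ⟨y, rfl⟩
    refine ⟨y.re, y.im, ?_⟩
    ext <;> simp <;> ring

/-- The index of a lattice in `ℤ[ω]`. -/
theorem index_closure_pair {α β : Eisenstein} (hD : (star α * β).im ≠ 0) :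
    (AddSubgroup.closure {α, β}).index = (star α * β).im.natAbs := by
  set N := AddSubgroup.closure {α, β} with hN
  have hα : α ∈ N := AddSubgroup.subset_closure (by simp)
  have hβ : β ∈ N := AddSubgroup.subset_closure (by simp)
  have hli : LinearIndependent ℤ ![(⟨α, hα⟩ : N), ⟨β, hβ⟩] := by
    rw [LinearIndependent.pair_iff]
    intro s t hst
    have h : s • α + t • β = 0 := congrArg Subtype.val hst
    -- Im(ᾱα) = Im(β̄β) = 0, so pairing the relation with α isolates t and pairing it with β
    -- isolates s.
    have h1 := congrArg (fun x => (star α * x).im) h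
    have h2 := congrArg (fun x => (star β * x).im) h
    have e1 : (star α * (s • α + t • β)).im = (star α * β).im * t := by simp; ring
    have e2 : (star β * (s • α + t • β)).im = (star α * β).im * -s := by simp; ring
    simp only [e1, e2, mul_zero, QuadraticAlgebra.im_zero] at h1 h2
    exact ⟨by simpa using (mul_eq_zero.1 h2).resolve_left hD, (mul_eq_zero.1 h1).resolve_left hD⟩
  have hsp : ⊤ ≤ Submodule.span ℤ (Set.range ![(⟨α, hα⟩ : N), ⟨β, hβ⟩]) := by
    rintro ⟨x, hx⟩ -
    obtain ⟨p, q, rfl⟩ := AddSubgroup.mem_closure_pair.1 hx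
    rw [Matrix.range_cons, Matrix.range_cons, Matrix.range_empty, Set.union_empty,
      Set.singleton_union, Submodule.mem_span_pair]
    exact ⟨p, q, rfl⟩
  rw [AddSubgroup.index_eq_natAbs_det (QuadraticAlgebra.basis (-1) 1) N (Module.Basis.mk hli hsp)]
  congr 1
  rw [Module.Basis.det_apply, Matrix.det_fin_two]
  simp [Module.Basis.toMatrix_apply, QuadraticAlgebra.basis_repr_apply]
  ring

end Eisenstein

/-! ### The embedding of ℤ[ω] in ℂ -/

namespace Eisenstein

theorem toComplex_apply (x : Eisenstein) : toComplex x = x.re + x.im * omegaC := rfl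

theorem toComplex_omega : toComplex QuadraticAlgebra.omega = omegaC := by
  simp [toComplex_apply]

theorem conj_omegaC : (starRingEnd ℂ) omegaC = 1 - omegaC := by
  simp only [omegaC, map_div₀, map_add, map_one, map_mul, Complex.conj_I, Complex.conj_ofReal,
    map_ofNat]
  ring

theorem toComplex_star (x : Eisenstein) : toComplex (star x) = (starRingEnd ℂ) (toComplex x) := by
  simp only [toComplex_apply, QuadraticAlgebra.re_star, QuadraticAlgebra.im_star, map_add, map_mul,
    map_intCast, conj_omegaC]
  push_cast
  ring

theorem sq_norm_toComplex (x : Eisenstein) : ‖toComplex x‖ ^ 2 = x.norm := by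
  have h : ((‖toComplex x‖ ^ 2 : ℝ) : ℂ) = ((x.norm : ℝ) : ℂ) := by
    rw [Complex.ofReal_pow, ← Complex.mul_conj', ← toComplex_star, ← map_mul, mul_star_self,
      map_intCast, Complex.ofReal_intCast]
  exact_mod_cast h

theorem toComplex_eq_zero {x : Eisenstein} : toComplex x = 0 ↔ x = 0 := by
  rw [← norm_eq_zero, ← _root_.norm_eq_zero, ← sq_eq_zero_iff, sq_norm_toComplex]
  exact Int.cast_eq_zero

theorem toComplex_injective : Function.Injective toComplex :=
  (injective_iff_map_eq_zero _).2 fun _ => toComplex_eq_zero.1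

/-- Up to the factor √3/2, Im(ᾱβ) is the determinant of the Cartesian coordinates of α and β. -/
theorem linearIndependent_toComplex_iff {α β : Eisenstein} :
    LinearIndependent ℝ ![toComplex α, toComplex β] ↔ (star α * β).im ≠ 0 := by
  have him : ∀ x : Eisenstein, (toComplex x).im = x.im * (Real.sqrt 3 / 2) := by
    intro x
    simp [toComplex_apply, omegaC]
  have h3 : Real.sqrt 3 / 2 ≠ 0 := by positivity
  have hre : ∀ x : Eisenstein, (toComplex x).re = x.re + x.im / 2 := by
    intro x
    simp [toComplex_apply, omegaC]
    ring
  have key : ((star α * β).im : ℝ) * (Real.sqrt 3 / 2) =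
      (toComplex α).re * (toComplex β).im - (toComplex α).im * (toComplex β).re := by
    rw [him, him, hre, hre]
    simp
    ring
  have key' : (star α * β).im ≠ 0 ↔
      (toComplex α).re * (toComplex β).im - (toComplex α).im * (toComplex β).re ≠ 0 := by
    rw [← key, mul_ne_zero_iff_right h3, Int.cast_ne_zero]
  rw [key', LinearIndependent.pair_iff]
  constructor
  · intro h h0
    have h1 := h (toComplex β).im (-(toComplex α).im) (by
      apply Complex.ext <;> simp <;> linarith)
    have h2 := h (toComplex β).re (-(toComplex α).re) (by
      apply Complex.ext <;> simp <;> linarith)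
    have := h 1 0 (by
      have : toComplex α = 0 := Complex.ext (by simpa using h2.2) (by simpa using h1.2)
      simp [this])
    exact one_ne_zero this.1
  · intro h s t hst
    have h1 := congrArg Complex.re hst
    have h2 := congrArg Complex.im hst
    simp at h1 h2
    constructor
    · apply (mul_eq_zero.1 (_ : s * _ = 0)).resolve_right h
      linear_combination (toComplex β).im * h1 - (toComplex β).re * h2
    · apply (mul_eq_zero.1 (_ : t * _ = 0)).resolve_right h
      linear_combination (toComplex α).re * h2 - (toComplex α).im * h1

/-- The third vertex of an equilateral triangle. -/
theorem eq_omegaC_mul_or {p q : ℂ} {s : ℝ} (hs : s ≠ 0) (hp : ‖p‖ = s) (hq : ‖q‖ = s)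
    (hpq : ‖p - q‖ = s) : q = omegaC * p ∨ q = (1 - omegaC) * p := by
  have hp0 : p ≠ 0 := by
    rintro rfl
    exact hs (by simpa using hp.symm)
  have h1 : p * (starRingEnd ℂ) p = (s : ℂ) ^ 2 := by rw [Complex.mul_conj', hp]
  have h2 : q * (starRingEnd ℂ) q = (s : ℂ) ^ 2 := by rw [Complex.mul_conj', hq]
  have h3 : (p - q) * (starRingEnd ℂ) (p - q) = (s : ℂ) ^ 2 := by rw [Complex.mul_conj', hpq]
  rw [map_sub] at h3
  set p' := (starRingEnd ℂ) p
  set q' := (starRingEnd ℂ) q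
  have hp' : p' ≠ 0 := by simpa [p'] using hp0
  -- The product is q² - pq + p². With w = p'q the hypotheses give w + w̄ = s² and w w̄ = s⁴, so w²
  -- - s²w + s⁴ = 0.
  have h4 : p' ^ 2 * ((q - omegaC * p) * (q - (1 - omegaC) * p)) = 0 := by
    linear_combination (-(p' ^ 2 * p ^ 2)) * omegaC_mul_self + p' * q * (h1 + h2 - h3) -
      p' * q * h1 + p * p' * (h1 - h2)
  rcases mul_eq_zero.1 ((mul_eq_zero.1 h4).resolve_left (pow_ne_zero 2 hp')) with h | h
  · exact Or.inl (sub_eq_zero.1 h)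
  · exact Or.inr (sub_eq_zero.1 h)

end Eisenstein

/-! ### Chirality of the tessellation -/

namespace SnubHexagonal

open Eisenstein

variable {μ : Eisenstein}

theorem side_pos : 0 < side := by
  unfold side
  positivity

theorem side_le_one : side ≤ 1 := by
  have : (1 : ℝ) ≤ Real.sqrt 7 := Real.one_le_sqrt.2 (by norm_num)
  unfold side
  rw [div_le_one (by positivity)]
  exact this

theorem norm_toComplex (hμ : μ.norm = 7) : ‖toComplex μ‖ = Real.sqrt 7 := by
  rw [← Real.sqrt_sq (_root_.norm_nonneg (toComplex μ)), sq_norm_toComplex, hμ]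
  norm_num

theorem toComplex_ne_zero (hμ : μ.norm = 7) : toComplex μ ≠ 0 := by
  rw [Ne, toComplex_eq_zero, ← Eisenstein.norm_eq_zero, hμ]
  norm_num

theorem norm_eq_of_mul_eq (hμ : μ.norm = 7) {z : ℂ} {x : Eisenstein}
    (h : toComplex μ * z = toComplex x) : ‖z‖ = side * ‖toComplex x‖ := by
  rw [← h, norm_mul, norm_toComplex hμ, side, ← mul_assoc,
    one_div_mul_cancel (by positivity), one_mul]

theorem norm_eq_side_iff (hμ : μ.norm = 7) {z : ℂ} {x : Eisenstein}
    (h : toComplex μ * z = toComplex x) : ‖z‖ = side ↔ x.norm = 1 := by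
  rw [norm_eq_of_mul_eq hμ h, mul_eq_left₀ side_pos.ne',
    ← pow_eq_one_iff_of_nonneg (_root_.norm_nonneg _) two_ne_zero, sq_norm_toComplex]
  exact_mod_cast Iff.rfl

theorem div_mem_vertexSet (hμ : μ.norm = 7) {u : Eisenstein} (hu : u.norm = 1) :
    toComplex u / toComplex μ ∈ vertexSet μ := by
  have h0 := toComplex_ne_zero hμ
  refine ⟨⟨u, by field_simp⟩, ?_⟩
  rintro ⟨c, hc⟩
  rw [div_eq_iff h0, ← map_mul] at hc
  have := congrArg QuadraticAlgebra.norm (toComplex_injective hc)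
  rw [map_mul, hu, hμ] at this
  omega

theorem norm_div_eq_side (hμ : μ.norm = 7) {u : Eisenstein} (hu : u.norm = 1) :
    ‖toComplex u / toComplex μ‖ = side :=
  (norm_eq_side_iff hμ (mul_div_cancel₀ _ (toComplex_ne_zero hμ))).2 hu

theorem norm_omega : (QuadraticAlgebra.omega : Eisenstein).norm = 1 := by
  simp [norm_eq]

theorem norm_one_sub_omega : (1 - QuadraticAlgebra.omega : Eisenstein).norm = 1 := by
  simp [norm_eq]

/-- The centres of the hexagons, described by the vertices. -/
theorem exists_eq_toComplex_iff (hμ : μ.norm = 7) (c : ℂ) :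
    (∃ e : Eisenstein, c = toComplex e) ↔ c ∉ vertexSet μ ∧
      ∃ v ∈ vertexSet μ, ∃ w ∈ vertexSet μ, dist c v = side ∧ dist c w = side ∧
        dist v w = side := by
  constructor
  · rintro ⟨e, rfl⟩
    refine ⟨fun h => h.2 ⟨e, rfl⟩, _, add_mem_vertexSet μ e (div_mem_vertexSet hμ (map_one _)), _,
      add_mem_vertexSet μ e (div_mem_vertexSet hμ norm_omega), ?_, ?_, ?_⟩
    · rw [dist_comm, dist_eq_norm, add_sub_cancel_right]
      exact norm_div_eq_side hμ (map_one _)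
    · rw [dist_comm, dist_eq_norm, add_sub_cancel_right]
      exact norm_div_eq_side hμ norm_omega
    · rw [dist_add_right, dist_eq_norm, ← sub_div, ← map_sub]
      exact norm_div_eq_side hμ norm_one_sub_omega
  -- The third vertex of an equilateral triangle on two points of μ⁻¹ℤ[ω] lies in μ⁻¹ℤ[ω]. A point
  -- of that lattice that is not a vertex belongs to ℤ[ω].
  · rintro ⟨hc, v, ⟨⟨x, hx⟩, -⟩, w, ⟨⟨y, hy⟩, -⟩, h1, h2, h3⟩
    by_contra hn
    refine hc ⟨?_, hn⟩
    rw [dist_comm, dist_eq_norm] at h1 h2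
    rw [dist_eq_norm] at h3
    rcases eq_omegaC_mul_or side_pos.ne' h1 h2 (by rwa [sub_sub_sub_cancel_right]) with h | h
    · refine ⟨QuadraticAlgebra.omega * y -
        QuadraticAlgebra.omega * QuadraticAlgebra.omega * x, ?_⟩
      simp only [map_sub, map_mul, toComplex_omega, ← hx, ← hy]
      linear_combination (-toComplex μ * omegaC) * h + (toComplex μ * c) * omegaC_mul_self
    · refine ⟨(1 - QuadraticAlgebra.omega) * y -
        (1 - QuadraticAlgebra.omega) * (1 - QuadraticAlgebra.omega) * x, ?_⟩
      simp only [map_sub, map_mul, map_one, toComplex_omega, ← hx, ← hy]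
      linear_combination (-toComplex μ * (1 - omegaC)) * h + (toComplex μ * c) * omegaC_mul_self

/-- The arithmetic source of chirality: μ and μ̄ are not associated. If μ̄ ∣ μ, then μ̄ divides the
trace 2a + b of μ = a + bω, so 7 ∣ 2a + b; but (2a + b)² + 3b² = 28 then forces 2a + b = 0 and 3b² =
28. -/
theorem not_star_dvd_mul (hμ : μ.norm = 7) {u : Eisenstein} (hu : u.norm = 1) :
    ¬ star μ ∣ μ * u := by
  intro h
  have h1 : star μ ∣ μ := by
    have := h.mul_right (star u)
    rwa [mul_assoc, mul_star_self, hu, Int.cast_one, mul_one] at this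
  have h2 : star μ ∣ ((μ.re * 2 + μ.im : ℤ) : Eisenstein) := by
    have : ((μ.re * 2 + μ.im : ℤ) : Eisenstein) = μ + star μ := by
      ext <;> simp
      ring
    rw [this]
    exact dvd_add h1 dvd_rfl
  obtain ⟨y, hy⟩ := h2
  have h3 := congrArg QuadraticAlgebra.norm hy
  rw [map_mul, QuadraticAlgebra.norm_star, hμ, QuadraticAlgebra.norm_intCast] at h3
  rw [norm_eq] at hμ
  obtain ⟨k, hk⟩ : (7 : ℤ) ∣ μ.re * 2 + μ.im :=
    (by norm_num : Prime (7 : ℤ)).dvd_of_dvd_pow ⟨_, h3⟩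
  have h4 : 49 * k ^ 2 + 3 * μ.im ^ 2 = 28 := by
    have : (μ.re * 2 + μ.im) ^ 2 + 3 * μ.im ^ 2 = 28 := by linear_combination 4 * hμ
    rw [hk] at this
    linarith
  have hk0 : k = 0 := by
    by_contra hk0
    have : 0 < k ^ 2 := by positivity
    nlinarith [sq_nonneg μ.im]
  subst hk0
  omega

/-- The tessellation is chiral: every symmetry is `z ↦ u z + b` with a unit `u`. -/
theorem exists_symmetry_eq (hμ : μ.norm = 7) (g : (tessellation μ).symmetryGroup) :
    ∃ u b : Eisenstein, u.norm = 1 ∧ ∀ z, g.1 z = toComplex u * z + toComplex b := by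
  have hV : ∀ z, g.1 z ∈ vertexSet μ ↔ z ∈ vertexSet μ := g.2.1
  -- Hexagon centres are characterized by vertices and distances alone, so a symmetry maps ℤ[ω] into
  -- itself.
  have hC : ∀ e : Eisenstein, ∃ e' : Eisenstein, g.1 (toComplex e) = toComplex e' := by
    intro e
    obtain ⟨h1, v, hv, w, hw, h2, h3, h4⟩ := (exists_eq_toComplex_iff hμ _).1 ⟨e, rfl⟩
    refine (exists_eq_toComplex_iff hμ _).2
      ⟨by rwa [hV], g.1 v, (hV v).2 hv, g.1 w, (hV w).2 hw, ?_, ?_, ?_⟩ <;>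
    rwa [g.1.isometry.dist_eq]
  obtain ⟨b, hb⟩ := hC 0
  obtain ⟨c, hc⟩ := hC 1
  rw [map_zero] at hb
  rw [map_one] at hc
  have hlin : ∀ z, g.1 z = g.1.toRealAffineIsometryEquiv.linearIsometryEquiv z + toComplex b := by
    intro z
    have := g.1.toRealAffineIsometryEquiv.map_vadd 0 z
    simpa [hb] using this
  obtain ⟨a, ha⟩ := linear_isometry_complex g.1.toRealAffineIsometryEquiv.linearIsometryEquiv
  -- The linear part is multiplication by a, possibly after conjugation; either way a = g(1) - g(0),
  -- an Eisenstein integer of modulus 1.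
  have haC : (a : ℂ) = toComplex (c - b) := by
    have := hlin 1
    rw [map_sub, ← hc, this]
    rcases ha with h | h <;> simp [h]
  have hu : (c - b).norm = 1 := by
    have h : ‖(a : ℂ)‖ ^ 2 = 1 := by rw [Circle.norm_coe, one_pow]
    rw [haC, sq_norm_toComplex] at h
    exact_mod_cast h
  refine ⟨c - b, b, hu, fun z => ?_⟩
  rcases ha with h | h
  · rw [hlin, h, ← haC]
    rfl
  -- An orientation-reversing g sends the vertex 1/μ to a/μ̄ + b. If this lay in μ⁻¹ℤ[ω], clearing
  -- denominators would give μ̄ ∣ μa.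
  · exfalso
    have h0 := toComplex_ne_zero hμ
    obtain ⟨⟨x, hx⟩, -⟩ := (hV _).2 (div_mem_vertexSet hμ (map_one _))
    rw [hlin, h] at hx
    have hx' : toComplex μ * (toComplex (c - b) * (starRingEnd ℂ (toComplex 1 / toComplex μ)) +
        toComplex b) = toComplex x := by
      rw [← haC]
      exact hx
    have h0' : toComplex (star μ) ≠ 0 := toComplex_ne_zero (by rwa [QuadraticAlgebra.norm_star])
    rw [map_one, map_div₀, map_one, ← toComplex_star] at hx'
    refine not_star_dvd_mul hμ hu ⟨x - μ * b, toComplex_injective ?_⟩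
    rw [map_mul, map_mul toComplex (star μ), map_sub toComplex x, map_mul toComplex μ b, ← hx']
    field_simp
    ring

end SnubHexagonal

/-! ### Rotations, a flag with trivial stabilizer, finiteness of flag orbits -/

namespace SnubHexagonal

open Eisenstein

variable {μ : Eisenstein}

theorem mul_mem_vertexSet {u : Eisenstein} (hu : u.norm = 1) {z : ℂ} (hz : z ∈ vertexSet μ) :
    toComplex u * z ∈ vertexSet μ := by
  obtain ⟨⟨x, hx⟩, hn⟩ := hz
  refine ⟨⟨u * x, ?_⟩, ?_⟩
  · rw [map_mul, ← hx]
    ring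
  · rintro ⟨c, hc⟩
    refine hn ⟨star u * c, ?_⟩
    rw [map_mul, ← hc, ← mul_assoc, ← map_mul, mul_comm (star u), mul_star_self, hu]
    simp

theorem norm_toComplex_unit {u : Eisenstein} (hu : u.norm = 1) : ‖toComplex u‖ = 1 := by
  rw [← pow_eq_one_iff_of_nonneg (_root_.norm_nonneg _) two_ne_zero, sq_norm_toComplex, hu,
    Int.cast_one]

theorem dist_unit_mul {u : Eisenstein} (hu : u.norm = 1) (v w : ℂ) :
    dist (toComplex u * v) (toComplex u * w) = dist v w := by
  rw [dist_eq_norm, ← mul_sub, norm_mul, norm_toComplex_unit hu, one_mul, dist_eq_norm]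

theorem image_mul_edge {u : Eisenstein} (hu : u.norm = 1) {s : Set ℂ}
    (hs : s ∈ (tessellation μ).edges) :
    (fun z => toComplex u * z) '' s ∈ (tessellation μ).edges := by
  obtain ⟨v, hv, w, hw, hd, rfl⟩ := hs
  exact ⟨_, mul_mem_vertexSet hu hv, _, mul_mem_vertexSet hu hw, by rwa [dist_unit_mul hu],
    _root_.image_segment ℝ (LinearMap.mulLeft ℝ (toComplex u)).toAffineMap v w⟩

theorem mul_star_mul {u : Eisenstein} (hu : u.norm = 1) (z : ℂ) :
    toComplex u * (toComplex (star u) * z) = z := by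
  rw [← mul_assoc, ← map_mul, mul_star_self, hu]
  simp

theorem star_mul_mul {u : Eisenstein} (hu : u.norm = 1) (z : ℂ) :
    toComplex (star u) * (toComplex u * z) = z := by
  rw [mul_left_comm, mul_star_mul hu]

theorem image_mul_face {u : Eisenstein} (hu : u.norm = 1) {s : Set ℂ}
    (hs : s ∈ (tessellation μ).faces) :
    (fun z => toComplex u * z) '' s ∈ (tessellation μ).faces := by
  have himage : ∀ A : Set ℂ, (fun z => toComplex u * z) '' convexHull ℝ A =
      convexHull ℝ ((fun z => toComplex u * z) '' A) :=
    (LinearMap.mulLeft ℝ (toComplex u)).image_convexHull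
  rcases hs with ⟨x, hx, v, hv, w, hw, h1, h2, h3, rfl⟩ | ⟨c, rfl⟩
  · refine Or.inl ⟨_, mul_mem_vertexSet hu hx, _, mul_mem_vertexSet hu hv, _,
      mul_mem_vertexSet hu hw, by rwa [dist_unit_mul hu], by rwa [dist_unit_mul hu],
      by rwa [dist_unit_mul hu], ?_⟩
    rw [himage, Set.image_insert_eq, Set.image_insert_eq, Set.image_singleton]
  · refine Or.inr ⟨u * c, ?_⟩
    rw [himage]
    congr 1
    ext z
    constructor
    · rintro ⟨v, ⟨hv, hd⟩, rfl⟩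
      exact ⟨mul_mem_vertexSet hu hv, by rwa [map_mul, dist_unit_mul hu]⟩
    · rintro ⟨hv, hd⟩
      refine ⟨toComplex (star u) * z,
        ⟨mul_mem_vertexSet (by rwa [QuadraticAlgebra.norm_star]) hv, ?_⟩, mul_star_mul hu z⟩
      rw [← dist_unit_mul hu, mul_star_mul hu, ← map_mul]
      exact hd

/-- The rotation `z ↦ u z` by a unit `u`, as a symmetry of the tessellation. -/
noncomputable def rotation (μ : Eisenstein) {u : Eisenstein} (hu : u.norm = 1) :
    (tessellation μ).symmetryGroup :=
  ⟨⟨⟨fun z => toComplex u * z, fun z => toComplex (star u) * z, star_mul_mul hu,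
      mul_star_mul hu⟩, Isometry.of_dist_eq (dist_unit_mul hu)⟩, by
    have hu' : (star u).norm = 1 := by rwa [QuadraticAlgebra.norm_star]
    have key : ∀ s : Set ℂ,
        (fun z => toComplex (star u) * z) '' ((fun z => toComplex u * z) '' s) = s := fun s => by
      rw [Set.image_image]
      simp only [star_mul_mul hu, Set.image_id']
    refine ⟨fun z => ⟨fun h => ?_, fun h => mul_mem_vertexSet hu h⟩,
      fun s => ⟨fun h => ?_, fun h => image_mul_edge hu h⟩,
      fun s => ⟨fun h => ?_, fun h => image_mul_face hu h⟩⟩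
    · rw [← star_mul_mul hu z]
      exact mul_mem_vertexSet hu' h
    · rw [← key s]
      exact image_mul_edge hu' h
    · rw [← key s]
      exact image_mul_face hu' h⟩

/-- The flag of the hexagon around `0` at the edge from `1 / μ` to `ω / μ`. -/
noncomputable def baseFlag (hμ : μ.norm = 7) : (tessellation μ).Flag where
  vertex := toComplex 1 / toComplex μ
  edge := segment ℝ (toComplex 1 / toComplex μ) (toComplex QuadraticAlgebra.omega / toComplex μ)
  face := convexHull ℝ {v | v ∈ vertexSet μ ∧ dist v (toComplex 0) = side}
  vertex_mem := div_mem_vertexSet hμ (map_one _)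
  edge_mem := by
    refine ⟨_, div_mem_vertexSet hμ (map_one _), _, div_mem_vertexSet hμ norm_omega, ?_, rfl⟩
    rw [dist_eq_norm, ← sub_div, ← map_sub]
    exact norm_div_eq_side hμ norm_one_sub_omega
  face_mem := Or.inr ⟨0, rfl⟩
  vertex_mem_edge := left_mem_segment ℝ _ _
  edge_subset_face := by
    have h : ∀ u : Eisenstein, u.norm = 1 → toComplex u / toComplex μ ∈
        {v | v ∈ vertexSet μ ∧ dist v (toComplex 0) = side} := fun u hu =>
      ⟨div_mem_vertexSet hμ hu, by rw [map_zero, dist_zero_right, norm_div_eq_side hμ hu]⟩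
    exact segment_subset_convexHull (h 1 (map_one _)) (h _ norm_omega)

/-- A symmetry fixing the vertex and the edge fixes both ends of the edge; in the absence of
reflections it is the identity. -/
theorem eq_one_of_smul_baseFlag (hμ : μ.norm = 7) {g : (tessellation μ).symmetryGroup}
    (hg : g • baseFlag hμ = baseFlag hμ) : g = 1 := by
  obtain ⟨u, b, hu, hub⟩ := exists_symmetry_eq hμ g
  set v := toComplex 1 / toComplex μ with hv
  set w := toComplex QuadraticAlgebra.omega / toComplex μ with hw
  have h1 : g.1 v = v := congrArg PlaneTessellation.Flag.vertex hg
  have h2 : g.1 '' segment ℝ v w = segment ℝ v w := congrArg PlaneTessellation.Flag.edge hg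
  have h3 : g.1 w ∈ segment ℝ v w := by
    rw [← h2]
    exact Set.mem_image_of_mem _ (right_mem_segment ℝ v w)
  have hvw : v - w ≠ 0 := by
    rw [← norm_ne_zero_iff, hv, hw, ← sub_div, ← map_sub, norm_div_eq_side hμ norm_one_sub_omega]
    exact side_pos.ne'
  -- The endpoint w is the only point of the segment at distance |v - w| from v.
  have h4 : g.1 w = w := by
    have hd : dist v (g.1 w) = dist v w := by
      conv_lhs => rw [← h1]
      exact g.1.isometry.dist_eq _ _
    have := dist_add_dist_of_mem_segment h3
    rw [hd, add_eq_left, dist_eq_zero] at this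
    exact this
  rw [hub] at h1 h4
  have h5 : toComplex u = 1 := by
    have : (toComplex u - 1) * (v - w) = 0 := by linear_combination h1 - h4
    exact sub_eq_zero.1 ((mul_eq_zero.1 this).resolve_right hvw)
  rw [h5, one_mul, add_eq_left] at h1
  ext z
  rw [hub, h5, h1]
  simp

theorem finite_setOf_norm_le (n : ℤ) : {x : Eisenstein | x.norm ≤ n}.Finite := by
  refine (((Set.finite_Icc (-2 * n) (2 * n)).prod (Set.finite_Icc (-2 * n) (2 * n))).image
    (fun p : ℤ × ℤ => (⟨p.1, p.2⟩ : Eisenstein))).subset ?_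
  intro x hx
  rw [Set.mem_ofPred_eq, norm_eq] at hx
  have h1 : x.re ^ 2 ≤ 2 * n := by
    nlinarith [sq_nonneg (x.re + x.im), sq_nonneg x.re, sq_nonneg x.im]
  have h2 : x.im ^ 2 ≤ 2 * n := by
    nlinarith [sq_nonneg (x.re + x.im), sq_nonneg x.re, sq_nonneg x.im]
  have habs : ∀ a : ℤ, a ^ 2 ≤ 2 * n → a ∈ Set.Icc (-2 * n) (2 * n) := by
    intro a ha
    rw [Set.mem_Icc]
    constructor <;> nlinarith [Int.le_self_sq a, Int.le_self_sq (-a)]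
  exact ⟨(x.re, x.im), ⟨habs _ h1, habs _ h2⟩, rfl⟩

theorem finite_vertexSet_norm_le (hμ : μ.norm = 7) (n : ℕ) :
    {z | z ∈ vertexSet μ ∧ ‖z‖ ≤ n}.Finite := by
  refine ((finite_setOf_norm_le (7 * n ^ 2)).image
    (fun x => toComplex x / toComplex μ)).subset ?_
  rintro z ⟨⟨⟨x, hx⟩, -⟩, hz⟩
  refine ⟨x, ?_, ?_⟩
  · have : ‖toComplex x‖ ^ 2 ≤ 7 * n ^ 2 := by
      rw [← hx, norm_mul, mul_pow, sq_norm_toComplex, hμ]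
      push_cast
      gcongr
    rw [sq_norm_toComplex] at this
    exact_mod_cast this
  · change toComplex x / toComplex μ = z
    rw [← hx]
    exact mul_div_cancel_left₀ _ (toComplex_ne_zero hμ)

theorem exists_edge_eq_convexHull {s : Set ℂ} (hs : s ∈ (tessellation μ).edges) :
    ∃ A ⊆ vertexSet μ, ∃ c, A ⊆ Metric.closedBall c side ∧ s = convexHull ℝ A := by
  obtain ⟨v, hv, w, hw, hd, rfl⟩ := hs
  refine ⟨{v, w}, ?_, v, ?_, (convexHull_pair v w).symm⟩
  · rintro z (rfl | rfl) <;> assumption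
  · rintro z (rfl | rfl)
    · exact Metric.mem_closedBall_self side_pos.le
    · rw [Metric.mem_closedBall, dist_comm, hd]

theorem exists_face_eq_convexHull {s : Set ℂ} (hs : s ∈ (tessellation μ).faces) :
    ∃ A ⊆ vertexSet μ, ∃ c, A ⊆ Metric.closedBall c side ∧ s = convexHull ℝ A := by
  rcases hs with ⟨u, hu, v, hv, w, hw, h1, h2, h3, rfl⟩ | ⟨c, rfl⟩
  · refine ⟨_, ?_, u, ?_, rfl⟩
    · rintro z (rfl | rfl | rfl) <;> assumption
    · rintro z (rfl | rfl | rfl)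
      · exact Metric.mem_closedBall_self side_pos.le
      · rw [Metric.mem_closedBall, dist_comm, h1]
      · rw [Metric.mem_closedBall, dist_comm, h3]
  · exact ⟨_, fun v hv => hv.1, toComplex c, fun v hv => hv.2.le, rfl⟩

/-- Edges and faces through a point of the unit disc are hulls of vertices of norm at most 1 + 2 ·
`side` ≤ 3, which leaves finitely many of them. -/
theorem subset_of_mem_convexHull {A : Set ℂ} {c z : ℂ} (hA : A ⊆ vertexSet μ)
    (hc : A ⊆ Metric.closedBall c side) (hz : z ∈ convexHull ℝ A) (h : ‖z‖ ≤ 1) :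
    A ⊆ {z | z ∈ vertexSet μ ∧ ‖z‖ ≤ (3 : ℕ)} := by
  intro v hv
  refine ⟨hA hv, ?_⟩
  have h1 : dist z c ≤ side := convexHull_min hc (convex_closedBall c side) hz
  have h2 : dist v c ≤ side := hc hv
  have h3 := side_le_one
  calc ‖v‖ = dist v 0 := (dist_zero_right v).symm
    _ ≤ dist v c + dist z c + dist z 0 := by
      linarith [dist_triangle v z 0, dist_triangle_right v z c]
    _ ≤ (3 : ℕ) := by
      rw [dist_zero_right]
      push_cast
      linarith

theorem finite_flags (hμ : μ.norm = 7) : {Φ : (tessellation μ).Flag | ‖Φ.vertex‖ ≤ 1}.Finite := by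
  set W := {z | z ∈ vertexSet μ ∧ ‖z‖ ≤ (3 : ℕ)}
  have hW : W.Finite := finite_vertexSet_norm_le hμ 3
  have hP : (convexHull ℝ '' 𝒫 W).Finite := hW.finite_subsets.image _
  refine Set.Finite.of_finite_image (f := fun Φ => (Φ.vertex, Φ.edge, Φ.face))
    ((hW.prod (hP.prod hP)).subset ?_) ?_
  · rintro _ ⟨Φ, hΦ, rfl⟩
    refine ⟨⟨Φ.vertex_mem, le_trans hΦ (by norm_num)⟩, ?_, ?_⟩
    · obtain ⟨A, hA, c, hc, h⟩ := exists_edge_eq_convexHull Φ.edge_mem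
      exact ⟨A, subset_of_mem_convexHull hA hc (h ▸ Φ.vertex_mem_edge) hΦ, h.symm⟩
    · obtain ⟨A, hA, c, hc, h⟩ := exists_face_eq_convexHull Φ.face_mem
      exact ⟨A, subset_of_mem_convexHull hA hc
        (h ▸ Φ.edge_subset_face Φ.vertex_mem_edge) hΦ, h.symm⟩
  · rintro Φ - Ψ - h
    simp only [Prod.mk.injEq] at h
    exact PlaneTessellation.Flag.ext h.1 h.2.1 h.2.2

/-- Division by μ translates any vertex into the unit disc, since a remainder has norm below 7 =
N(μ). Finiteness matters because almost regularity compares cardinalities only. -/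
theorem finite_flagOrbits (hμ : μ.norm = 7) :
    Finite (MulAction.orbitRel.Quotient (tessellation μ).symmetryGroup (tessellation μ).Flag) := by
  have := (finite_flags hμ).to_subtype
  refine Finite.of_surjective
    (fun Φ : {Φ : (tessellation μ).Flag | ‖Φ.vertex‖ ≤ 1} => Quotient.mk'' Φ.1) ?_
  intro x
  induction x using Quotient.inductionOn' with
  | h Φ =>
    obtain ⟨x, hx⟩ := Φ.vertex_mem.1
    have hμ0 : μ ≠ 0 := by
      rintro rfl
      simp at hμ
    obtain ⟨q, hq⟩ := exists_norm_sub_mul_lt x hμ0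
    have hmul : toComplex μ * (Φ.vertex + toComplex (-q)) = toComplex (x - q * μ) := by
      rw [mul_add, hx, map_sub, map_mul, map_neg]
      ring
    refine ⟨⟨translation μ (-q) • Φ, ?_⟩, Quotient.sound' ⟨translation μ (-q), rfl⟩⟩
    change ‖Φ.vertex + toComplex (-q)‖ ≤ 1
    have h1 : ‖toComplex μ * (Φ.vertex + toComplex (-q))‖ ^ 2 < 7 := by
      rw [hmul, sq_norm_toComplex]
      rw [hμ] at hq
      exact_mod_cast hq
    rw [norm_mul, mul_pow, sq_norm_toComplex, hμ] at h1
    push_cast at h1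
    nlinarith [_root_.norm_nonneg (Φ.vertex + toComplex (-q))]

theorem eq_one_of_smul_eq {g : (tessellation μ).symmetryGroup}
    (hg : g ∈ (tessellation μ).translationGroup) {Φ : (tessellation μ).Flag} (h : g • Φ = Φ) :
    g = 1 := by
  obtain ⟨t, ht⟩ := hg
  have h1 : g.1 Φ.vertex = Φ.vertex := congrArg PlaneTessellation.Flag.vertex h
  rw [ht, add_eq_left] at h1
  ext z
  rw [ht, h1]
  simp

end SnubHexagonal

/-! ### Almost regularity as normality, and fibres of coverings -/

namespace PlaneTessellation.ToroidalMap

variable {τ : PlaneTessellation} {N M : τ.ToroidalMap}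

theorem group_le_translationGroup (M : τ.ToroidalMap) : M.group ≤ τ.translationGroup := by
  obtain ⟨g, hg, h, hh, -, hM⟩ := M.exists_generators
  rw [hM, Subgroup.closure_le]
  rintro _ (rfl | rfl) <;> assumption

theorem proj_eq_proj_iff {Φ Ψ : τ.Flag} : M.proj Φ = M.proj Ψ ↔ ∃ g ∈ M.group, g • Ψ = Φ := by
  unfold proj
  rw [Quotient.eq'']
  constructor
  · rintro ⟨g, rfl⟩
    exact ⟨g.1, g.2, rfl⟩
  · rintro ⟨g, hg, rfl⟩
    exact ⟨⟨g, hg⟩, rfl⟩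

/-- A flag orbit of `τ / G` as a flag orbit of `τ`. -/
noncomputable def flagOrbitMap (M : τ.ToroidalMap) : MulAction.orbitRel.Quotient M.autGroup M.Flag →
    MulAction.orbitRel.Quotient τ.symmetryGroup τ.Flag :=
  Quotient.lift
    (Quotient.map' id (by
      rintro Φ Ψ ⟨g, hg⟩
      exact ⟨g.1, hg⟩) : M.Flag → MulAction.orbitRel.Quotient τ.symmetryGroup τ.Flag) (by
    rintro x y ⟨⟨_, n, rfl⟩, rfl⟩
    induction y using Quotient.inductionOn' with
    | h Φ => exact Quotient.sound' ⟨n.1, rfl⟩)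

theorem flagOrbitMap_surjective (M : τ.ToroidalMap) : Function.Surjective M.flagOrbitMap := by
  intro x
  induction x using Quotient.inductionOn' with
  | h Φ => exact ⟨Quotient.mk'' (M.proj Φ), rfl⟩

/-- G lies in its own normalizer, so the ambiguity of lifting a flag of τ/G is absorbed by the
normalizer. -/
theorem mk_proj_eq_mk_proj_iff {Φ Ψ : τ.Flag} :
    (Quotient.mk'' (M.proj Φ) : MulAction.orbitRel.Quotient M.autGroup M.Flag) =
      Quotient.mk'' (M.proj Ψ) ↔ ∃ n ∈ M.sym, n • Ψ = Φ := by
  rw [Quotient.eq'']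
  constructor
  · rintro ⟨⟨_, n, rfl⟩, h⟩
    obtain ⟨g, hg, h'⟩ := proj_eq_proj_iff.1 (h : M.proj (n.1 • Ψ) = M.proj Φ)
    change g • Φ = n.1 • Ψ at h'
    refine ⟨g⁻¹ * n, mul_mem (inv_mem (Subgroup.le_normalizer hg)) n.2, ?_⟩
    rw [mul_smul, ← h', inv_smul_smul]
  · rintro ⟨n, hn, rfl⟩
    exact ⟨⟨_, ⟨n, hn⟩, rfl⟩, rfl⟩

/-- Flag orbits of τ/G surject onto those of τ, so equal finite counts force injectivity. Then for
every symmetry s some n in the normalizer has nΦ = sΦ, and the trivial stabilizer of Φ gives n = s.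
Conversely, a full normalizer makes the surjection injective. -/
theorem isAlmostRegular_iff_normal
    [Finite (MulAction.orbitRel.Quotient τ.symmetryGroup τ.Flag)] {Φ : τ.Flag}
    (hΦ : ∀ g : τ.symmetryGroup, g • Φ = Φ → g = 1) : M.IsAlmostRegular ↔ M.group.Normal := by
  rw [← Subgroup.normalizer_eq_top_iff]
  constructor
  · intro h
    unfold IsAlmostRegular numFlagOrbits PlaneTessellation.numFlagOrbits at h
    have hfin : Finite (MulAction.orbitRel.Quotient M.autGroup M.Flag) := by
      rw [← ENat.card_lt_top, h, ENat.card_lt_top]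
      infer_instance
    have hcard : Nat.card (MulAction.orbitRel.Quotient M.autGroup M.Flag) =
        Nat.card (MulAction.orbitRel.Quotient τ.symmetryGroup τ.Flag) := congrArg ENat.toNat h
    have hinj :=
      ((Nat.bijective_iff_surjective_and_card _).2 ⟨M.flagOrbitMap_surjective, hcard⟩).injective
    rw [Subgroup.eq_top_iff']
    intro s
    have h1 : M.flagOrbitMap (Quotient.mk'' (M.proj (s • Φ))) =
        M.flagOrbitMap (Quotient.mk'' (M.proj Φ)) := Quotient.sound' ⟨s, rfl⟩
    obtain ⟨n, hn, h2⟩ := mk_proj_eq_mk_proj_iff.1 (hinj h1)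
    have h3 := hΦ (s⁻¹ * n) (by rw [mul_smul, h2, inv_smul_smul])
    rwa [← inv_mul_eq_one.1 h3] at hn
  · intro h
    refine ENat.card_congr (Equiv.ofBijective _ ⟨?_, M.flagOrbitMap_surjective⟩)
    intro x y hxy
    induction x using Quotient.inductionOn' with
    | h x =>
    induction y using Quotient.inductionOn' with
    | h y =>
    induction x using Quotient.inductionOn' with
    | h Φ =>
    induction y using Quotient.inductionOn' with
    | h Ψ =>
    obtain ⟨n, hn⟩ := Quotient.exact' hxy
    refine mk_proj_eq_mk_proj_iff.2 ⟨n, ?_, hn⟩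
    rw [sym, h]
    trivial

/-- Every fibre of a covering has as many flags as the index of the groups. -/
theorem card_fibre (hfree : ∀ g ∈ τ.translationGroup, ∀ Φ : τ.Flag, g • Φ = Φ → g = 1)
    (hc : N.Covers M) (x : M.Flag) :
    Nat.card {y // coveringMap hc y = x} = N.group.relIndex M.group := by
  induction x using Quotient.inductionOn' with
  | h Φ =>
  rw [Subgroup.relIndex, Subgroup.index]
  -- The coset of g goes to the orbit of g⁻¹Φ: the inverse turns left cosets of the smaller group
  -- into its orbits.
  refine (Nat.card_congr (Equiv.ofBijective (Quotient.lift (fun g : M.group =>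
    (⟨N.proj ((g⁻¹ : M.group).1 • Φ), proj_eq_proj_iff.2 ⟨(g⁻¹ : M.group).1, (g⁻¹).2, rfl⟩⟩ :
      {y // coveringMap hc y = M.proj Φ})) ?_) ⟨?_, ?_⟩)).symm
  · intro a b hab
    have hab' : a⁻¹ * b ∈ N.group.subgroupOf M.group := QuotientGroup.leftRel_apply.1 hab
    refine Subtype.ext (proj_eq_proj_iff.2 ⟨_, hab', ?_⟩)
    rw [smul_smul]
    simp
  · intro p q
    induction p using Quotient.inductionOn' with
    | h a =>
    induction q using Quotient.inductionOn' with
    | h b =>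
    intro hab
    obtain ⟨g, hg, hgab⟩ := proj_eq_proj_iff.1 (congrArg Subtype.val hab)
    -- Freeness of the translation action turns an equality of flags into one of group elements.
    have h1 : a.1 * g * b.1⁻¹ = 1 := by
      refine hfree _ (M.group_le_translationGroup
        (mul_mem (mul_mem a.2 (hc hg)) (inv_mem b.2))) Φ ?_
      rw [mul_smul, mul_smul]
      change a.1 • g • (b⁻¹ : M.group).1 • Φ = Φ
      rw [hgab, smul_smul]
      simp
    refine Quotient.sound' (QuotientGroup.leftRel_apply.2 ?_)
    change a.1⁻¹ * b.1 ∈ N.group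
    rw [mul_inv_eq_one] at h1
    rwa [← h1, inv_mul_cancel_left]
  · rintro ⟨y, hy⟩
    induction y using Quotient.inductionOn' with
    | h Ψ =>
    obtain ⟨g, hg, rfl⟩ := proj_eq_proj_iff.1 (hy : M.proj Ψ = M.proj Φ)
    refine ⟨Quotient.mk'' ⟨g, hg⟩⁻¹, Subtype.ext ?_⟩
    change N.proj _ = N.proj _
    rw [inv_inv]

end PlaneTessellation.ToroidalMap

/-! ### Toroidal maps as lattices in ℤ[ω] -/

namespace SnubHexagonal

open Eisenstein PlaneTessellation

variable {μ : Eisenstein}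

theorem translation_apply (t : Eisenstein) (z : ℂ) :
    (translation μ t).1 z = z + toComplex t := rfl

theorem symmetry_ext {g h : (tessellation μ).symmetryGroup} (H : ∀ z, g.1 z = h.1 z) : g = h :=
  Subtype.ext (IsometryEquiv.ext H)

/-- The translations by `ℤ[ω]`, as a homomorphism. -/
noncomputable def translationHom (μ : Eisenstein) :
    Multiplicative Eisenstein →* (tessellation μ).symmetryGroup where
  toFun t := translation μ t.toAdd
  map_one' := symmetry_ext fun z => by
    rw [translation_apply]
    simp
  map_mul' s t := symmetry_ext fun z => by
    rw [Subgroup.coe_mul, IsometryEquiv.mul_apply, translation_apply, translation_apply,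
      translation_apply, toAdd_mul, map_add]
    ring

theorem translationHom_injective : Function.Injective (translationHom μ) := by
  intro s t h
  have h1 : (translation μ s.toAdd).1 0 = (translation μ t.toAdd).1 0 := congrArg (fun g => g.1 0) h
  rw [translation_apply, translation_apply, zero_add, zero_add] at h1
  exact toComplex_injective h1

/-- The vector of a translation is the image of 0, a hexagon centre, hence an element of ℤ[ω]. -/
theorem exists_translation_eq (hμ : μ.norm = 7) {g : (tessellation μ).symmetryGroup}
    (hg : g ∈ (tessellation μ).translationGroup) : ∃ t, translation μ t = g := by
  obtain ⟨u, b, -, hub⟩ := exists_symmetry_eq hμ g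
  obtain ⟨t, ht⟩ := hg
  refine ⟨b, symmetry_ext fun z => ?_⟩
  have h0 := hub 0
  rw [ht, zero_add, mul_zero, zero_add] at h0
  rw [translation_apply, ht, h0]

/-- The vectors of the translations in the group of a toroidal map. -/
noncomputable def lattice (M : (tessellation μ).ToroidalMap) : AddSubgroup Eisenstein :=
  AddSubgroup.toSubgroup.symm (M.group.comap (translationHom μ))

theorem mem_lattice {M : (tessellation μ).ToroidalMap} {t : Eisenstein} :
    t ∈ lattice M ↔ translation μ t ∈ M.group := Iff.rfl

theorem group_eq_map_lattice (hμ : μ.norm = 7) (M : (tessellation μ).ToroidalMap) :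
    M.group = (AddSubgroup.toSubgroup (lattice M)).map (translationHom μ) := by
  refine (Subgroup.map_comap_eq_self fun g hg => ?_).symm
  obtain ⟨t, rfl⟩ := exists_translation_eq hμ (M.group_le_translationGroup hg)
  exact ⟨Multiplicative.ofAdd t, rfl⟩

theorem covers_iff (hμ : μ.norm = 7) {N M : (tessellation μ).ToroidalMap} :
    N.Covers M ↔ lattice N ≤ lattice M := by
  refine ⟨fun h t ht => h ht, fun h g hg => ?_⟩
  obtain ⟨t, rfl⟩ := exists_translation_eq hμ (N.group_le_translationGroup hg)
  exact h hg

theorem relIndex_eq (hμ : μ.norm = 7) (N M : (tessellation μ).ToroidalMap) :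
    N.group.relIndex M.group = (lattice N).relIndex (lattice M) := by
  rw [group_eq_map_lattice hμ N, group_eq_map_lattice hμ M,
    Subgroup.relIndex_map_map_of_injective _ _ translationHom_injective,
    AddSubgroup.relIndex_toSubgroup]

theorem mem_lattice_torus {α β : Eisenstein} (h : LinearIndependent ℝ ![toComplex α, toComplex β])
    {t : Eisenstein} : t ∈ lattice (torus μ α β h) ↔ ∃ p q : ℤ, p • α + q • β = t := by
  have h1 : (torus μ α β h).group =
      (Subgroup.closure {Multiplicative.ofAdd α, Multiplicative.ofAdd β}).map
        (translationHom μ) := by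
    rw [MonoidHom.map_closure, Set.image_pair]
    rfl
  rw [mem_lattice, h1]
  change translationHom μ (Multiplicative.ofAdd t) ∈ _ ↔ _
  rw [Subgroup.mem_map_iff_mem translationHom_injective, Subgroup.mem_closure_pair]
  rfl

theorem lattice_torus {α β : Eisenstein} (h : LinearIndependent ℝ ![toComplex α, toComplex β]) :
    lattice (torus μ α β h) = AddSubgroup.closure {α, β} := by
  ext t
  rw [mem_lattice_torus, AddSubgroup.mem_closure_pair]

/-- Conjugation by z ↦ uz + b multiplies translation vectors by u. The rotation by ω gives one
direction; conversely, an ω-stable subgroup is an ideal, hence stable under every u. -/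
theorem isAlmostRegular_iff (hμ : μ.norm = 7) {M : (tessellation μ).ToroidalMap} :
    M.IsAlmostRegular ↔ ∀ t ∈ lattice M, QuadraticAlgebra.omega * t ∈ lattice M := by
  have := finite_flagOrbits hμ
  rw [ToroidalMap.isAlmostRegular_iff_normal fun g => eq_one_of_smul_baseFlag hμ]
  constructor
  · intro h t ht
    have h1 := h.conj_mem _ ht (rotation μ norm_omega)
    rw [mem_lattice]
    convert h1
    rw [eq_mul_inv_iff_mul_eq]
    refine symmetry_ext fun z => ?_
    change toComplex QuadraticAlgebra.omega * z + toComplex (QuadraticAlgebra.omega * t) =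
      toComplex QuadraticAlgebra.omega * (z + toComplex t)
    rw [map_mul]
    ring
  · intro h
    have hmul : ∀ u : Eisenstein, ∀ t ∈ lattice M, u * t ∈ lattice M := by
      intro u t ht
      have : u * t = u.re • t + u.im • (QuadraticAlgebra.omega * t) := by
        ext <;> simp
        ring
      rw [this]
      exact add_mem (zsmul_mem ht _) (zsmul_mem (h t ht) _)
    refine ⟨fun n hn g => ?_⟩
    obtain ⟨t, rfl⟩ := exists_translation_eq hμ (M.group_le_translationGroup hn)
    obtain ⟨u, b, -, hub⟩ := exists_symmetry_eq hμ g
    convert mem_lattice.1 (hmul u t hn)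
    rw [mul_inv_eq_iff_eq_mul]
    refine symmetry_ext fun z => ?_
    change g.1 (z + toComplex t) = g.1 z + toComplex (u * t)
    rw [hub, hub, map_mul]
    ring

end SnubHexagonal

/-! ### The least almost regular cover and its number of sheets -/

theorem mainTheorem2 (μ : Eisenstein) (hμ : μ.norm = 7)
    (α β γ η : Eisenstein)
    (hαβ : LinearIndependent ℝ ![Eisenstein.toComplex α, Eisenstein.toComplex β])
    (hγ : Eisenstein.IsGCD γ α β)
    (hη : η = ((star α * β).im / γ.norm) • γ) :
    -- the quotient defining `η` is exact
    γ.norm ≠ 0 ∧ γ.norm ∣ (star α * β).im ∧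
    ∃ hη' : LinearIndependent ℝ
        ![Eisenstein.toComplex η, Eisenstein.toComplex (QuadraticAlgebra.omega * η)],
      -- `τ_η` is a minimal almost regular cover of `τ_{α,β}`, and the only one
      (SnubHexagonal.torus μ η (QuadraticAlgebra.omega * η) hη').IsMinimalAlmostRegularCoverOf
        (SnubHexagonal.torus μ α β hαβ) ∧
      (∀ N : (SnubHexagonal.tessellation μ).ToroidalMap,
        N.IsMinimalAlmostRegularCoverOf (SnubHexagonal.torus μ α β hαβ) →
          N = SnubHexagonal.torus μ η (QuadraticAlgebra.omega * η) hη') ∧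
      -- the number of sheets, as the index of the groups and as the size of every fibre
      ((SnubHexagonal.torus μ η (QuadraticAlgebra.omega * η) hη').group.relIndex
          (SnubHexagonal.torus μ α β hαβ).group : ℤ) = |(star α * β).im| / γ.norm ∧
      ∃ hc : (SnubHexagonal.torus μ η (QuadraticAlgebra.omega * η) hη').Covers
          (SnubHexagonal.torus μ α β hαβ),
        ∀ x : (SnubHexagonal.torus μ α β hαβ).Flag,
          (Nat.card {y // PlaneTessellation.ToroidalMap.coveringMap hc y = x} : ℤ) =
            |(star α * β).im| / γ.norm := by
  have hD := Eisenstein.linearIndependent_toComplex_iff.1 hαβ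
  obtain ⟨k, hk⟩ := hγ.norm_dvd
  have hγ0 : γ.norm ≠ 0 := by
    intro h0
    rw [h0, zero_mul] at hk
    exact hD hk
  have hk0 : k ≠ 0 := by
    rintro rfl
    rw [mul_zero] at hk
    exact hD hk
  have hηk : η = k • γ := by rw [hη, hk, Int.mul_ediv_cancel_left _ hγ0]
  have hηn : η.norm = k ^ 2 * γ.norm := by
    rw [hηk, zsmul_eq_mul, map_mul, QuadraticAlgebra.norm_intCast, Int.cast_id]
  have hDη : (star η * (QuadraticAlgebra.omega * η)).im ≠ 0 := by
    rw [Eisenstein.im_star_mul_omega_mul, hηn]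
    exact mul_ne_zero (pow_ne_zero 2 hk0) hγ0
  have hη' := Eisenstein.linearIndependent_toComplex_iff.2 hDη
  refine ⟨hγ0, hγ.norm_dvd, hη', ?_⟩
  set T := SnubHexagonal.torus μ η (QuadraticAlgebra.omega * η) hη' with hT
  set M := SnubHexagonal.torus μ α β hαβ with hM
  have hmemT : ∀ t, t ∈ SnubHexagonal.lattice T ↔ η ∣ t := fun t => by
    rw [hT, SnubHexagonal.mem_lattice_torus, Eisenstein.dvd_iff_exists_smul_add]
  have hdvd : ∀ t, η ∣ t ↔ t ∈ SnubHexagonal.lattice M ∧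
      QuadraticAlgebra.omega * t ∈ SnubHexagonal.lattice M := fun t => by
    rw [hM, SnubHexagonal.mem_lattice_torus, SnubHexagonal.mem_lattice_torus, hη,
      hγ.dvd_iff_mem_lattice hD]
  have hle : SnubHexagonal.lattice T ≤ SnubHexagonal.lattice M := fun t ht =>
    ((hdvd t).1 ((hmemT t).1 ht)).1
  have hcov : T.Covers M := (SnubHexagonal.covers_iff hμ).2 hle
  have hreg : T.IsAlmostRegular := (SnubHexagonal.isAlmostRegular_iff hμ).2 fun t ht =>
    (hmemT _).2 (((hmemT t).1 ht).mul_left _)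
  -- The lattice of an almost regular cover is an ideal inside Λ, so it lies in (η). Thus `T` is a
  -- least element, which yields both minimality and uniqueness.
  have hmax : ∀ N : (SnubHexagonal.tessellation μ).ToroidalMap, N.IsAlmostRegular → N.Covers M →
      N.Covers T := by
    intro N hN hNM
    rw [SnubHexagonal.covers_iff hμ] at hNM ⊢
    intro t ht
    exact (hmemT t).2 ((hdvd t).2 ⟨hNM ht, hNM ((SnubHexagonal.isAlmostRegular_iff hμ).1 hN t ht)⟩)
  have hindex : (T.group.relIndex M.group : ℤ) = |(star α * β).im| / γ.norm := by
    -- Multiplicativity of the index reads K · |D| = N(η), that is, K · N(γ)|k| = k²N(γ), whence K =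
    -- |k|.
    have h1 := AddSubgroup.relIndex_mul_index hle
    rw [hT, hM, SnubHexagonal.lattice_torus, SnubHexagonal.lattice_torus,
      Eisenstein.index_closure_pair hD, Eisenstein.index_closure_pair hDη,
      Eisenstein.im_star_mul_omega_mul, hηn, ← SnubHexagonal.lattice_torus hη',
      ← SnubHexagonal.lattice_torus hαβ, ← SnubHexagonal.relIndex_eq hμ] at h1
    have h2 := congrArg (Nat.cast : ℕ → ℤ) h1
    rw [Nat.cast_mul, Int.natCast_natAbs, Int.natCast_natAbs, hk, abs_mul, abs_mul, abs_pow] at h2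
    have hpos : 0 < |γ.norm| * |k| := by positivity
    have h3 : (T.group.relIndex M.group : ℤ) = |k| := by
      refine mul_right_cancel₀ hpos.ne' (h2.trans ?_)
      ring
    rw [h3, hk, abs_mul, abs_of_nonneg (Eisenstein.norm_nonneg γ), Int.mul_ediv_cancel_left _ hγ0]
  refine ⟨⟨hreg, hcov, fun N hN hNM hTN => ?_⟩, fun N hN => ?_, hindex, hcov, fun x => ?_⟩
  · exact PlaneTessellation.ToroidalMap.ext (le_antisymm (hmax N hN hNM) hTN)
  · exact (hN.2.2 T hreg hcov (hmax N hN.1 hN.2.1)).symm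
  · rw [PlaneTessellation.ToroidalMap.card_fibre
      (fun g hg Φ => SnubHexagonal.eq_one_of_smul_eq hg) hcov x, hindex]
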